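/- Let $q\ge 2$ and $n$ be integers. Consider $n$ qudits of dimension $q$, numbered $1,\dots,n$, and independent Haar-random unitaries $U_1,\dots,U_{n-1}\in U(q^2)$, where $U_k$ acts on the qudits $k$ and $k+1$. The noiseless convolutional circuit is $U=U_{n-1}\cdots U_2U_1$, applied to $|0\rangle^{\otimes n}$. The qudits $1,\dots,n-1$ are idle, and the rewinding circuit undoes, in reverse order, the gates that act only on idle qudits, which gives the state $$|\psi\rangle = U_1^\dagger U_2^\dagger\cdots U_{n-2}^\dagger\, U_{n-1}U_{n-2}\cdots U_1|0\rangle^{\otimes n}.$$ Let $P_i=|0\rangle\langle 0|_i\otimes I$, and define the averaged fidelities of resetting qudit $i$, and of resetting qudits $i$ and $j$ jointly, by $F_i=\mathbb E\,\langle\psi|P_i|\psi\rangle$ and $F_{ij}=\mathbb E\,\langle\psi|P_iP_j|\psi\rangle$. Then: 1. For $1<i<n$, $$F_i = 1-\frac{q-1}{q}\left(\frac{q^2}{q^2+1}\right)^{n-i}.$$ 2. For $1<j<i<n$, $$F_{ij} = 1-\frac{q-1}{q}\left(\frac{q^2}{q^2+1}\right)^{n-i}\left(1+\frac1q\left(\frac{q^2}{q^2+1}\right)^{i-j}\right).$$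 3. For $1<j<i<n$, the connected correlation is $$F_{ij}-F_iF_j=\left(\frac{q-1}{q}\right)^2\left(\frac{q^2}{q^2+1}\right)^{n-j}\left(1-\left(\frac{q^2}{q^2+1}\right)^{n-i}\right).$$ -/

import Mathlib

open MeasureTheory

/-! ### Two-qudit unitaries and their Haar probability measure -/

/-- The unitary group `U(q²)` of two-qudit gates, with local dimension `q`. -/
abbrev TwoQuditUnitary (q : ℕ) := Matrix.unitaryGroup (Fin q × Fin q) ℂ

noncomputable instance TwoQuditUnitary.instMeasurableSpace (q : ℕ) : MeasurableSpace (TwoQuditUnitary q) :=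
  borel _

instance TwoQuditUnitary.instBorelSpace (q : ℕ) : BorelSpace (TwoQuditUnitary q) := ⟨rfl⟩

instance TwoQuditUnitary.instCompactSpace (q : ℕ) : CompactSpace (TwoQuditUnitary q) := by
  apply isCompact_iff_compactSpace.mp
  have hK : IsCompact (Set.pi Set.univ fun _ : Fin q × Fin q =>
      Set.pi Set.univ fun _ : Fin q × Fin q => Metric.closedBall (0 : ℂ) 1) :=
    isCompact_univ_pi fun _ => isCompact_univ_pi fun _ => isCompact_closedBall _ _
  refine IsCompact.of_isClosed_subset hK
    (isClosed_unitary (R := Matrix (Fin q × Fin q) (Fin q × Fin q) ℂ)) ?_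
  intro U hU a _ b _
  simpa using entry_norm_bound_of_unitary hU a b

/-- The Haar measure on `U(q²)`, normalized to have total mass `1`. -/
noncomputable def haarProb (q : ℕ) : Measure (TwoQuditUnitary q) :=
  Measure.haarMeasure ⊤

/-! ### Circuits on `n` qudits

The computational basis of `(ℂ^q)^{⊗n}` is indexed by `Fin n → Fin q`; the `0`-based index
`k : Fin n` stands for the qudit number `k + 1`. -/

/-- State vectors of `n` qudits, written in the computational basis. -/
abbrev QuditState (n q : ℕ) := (Fin n → Fin q) → ℂ

/-- Operators on `n` qudits, written in the computational basis. -/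
abbrev QuditOp (n q : ℕ) := Matrix (Fin n → Fin q) (Fin n → Fin q) ℂ

/-- A two-qudit gate: the unitary `U` acts on two distinct qudits `a` and `b`, in this order. -/
structure Gate (n q : ℕ) where
  a : Fin n
  b : Fin n
  ne : a ≠ b
  U : TwoQuditUnitary q

/-- The operator `U_{ab} ⊗ I` on `n` qudits. -/
def Gate.op {n q : ℕ} (g : Gate n q) : QuditOp n q :=
  Matrix.of fun x y =>
    if ∀ k, k ≠ g.a → k ≠ g.b → x k = y k then
      (g.U : Matrix (Fin q × Fin q) (Fin q × Fin q) ℂ) (x g.a, x g.b) (y g.a, y g.b)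
    else 0

/-- The inverse gate `g†`. -/
def Gate.dagger {n q : ℕ} (g : Gate n q) : Gate n q :=
  { g with U := star g.U }

/-- `U(C) = g_N ⋯ g_2 g_1` for the circuit `C = (g_1, g_2, …, g_N)`. -/
def circuitOp {n q : ℕ} (C : List (Gate n q)) : QuditOp n q :=
  (C.map Gate.op).reverse.prod

/-- The rewinding circuit: the gates of `C` that act only on idle qudits are inverted, and applied
in the reverse order. -/
def rewind {n q : ℕ} (idle : Finset (Fin n)) (C : List (Gate n q)) : List (Gate n q) :=
  ((C.filter fun g => g.a ∈ idle ∧ g.b ∈ idle).map Gate.dagger).reverse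

/-- The `0`-based qudits `0, …, n - 2`; only the last qudit is still in use. -/
def idleQudits (n : ℕ) : Finset (Fin n) :=
  Finset.univ.filter fun k => (k : ℕ) + 1 < n

/-- The convolutional circuit with two-qudit window: for `k = 1, …, n - 1` in this order, a gate
acts on the neighbouring qudits `k` and `k + 1`. -/
def convCircuit (n q : ℕ) (U : Fin (n - 1) → TwoQuditUnitary q) : List (Gate n q) :=
  List.ofFn fun k : Fin (n - 1) =>
    { a := ⟨k, by omega⟩
      b := ⟨k + 1, by omega⟩
      ne := by simp
      U := U k }

/-! ### Fidelity of the rewinding protocol -/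

/-- The initial state `|0⟩^{⊗n}`. -/
def zeroState (n q : ℕ) [NeZero q] : QuditState n q :=
  fun x => if ∀ k, x k = 0 then 1 else 0

/-- The state after the convolutional circuit followed by the rewinding circuit. -/
def rewoundState (n q : ℕ) [NeZero q] (U : Fin (n - 1) → TwoQuditUnitary q) : QuditState n q :=
  (circuitOp (rewind (idleQudits n) (convCircuit n q U)) * circuitOp (convCircuit n q U)).mulVec
    (zeroState n q)

/-- The projector onto `|0⟩` for all the qudits whose (`1`-based) number lies in `S`, tensored with
the identity on the other qudits. -/
def zeroProjector (n q : ℕ) [NeZero q] (S : Finset ℕ) : QuditOp n q :=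
  Matrix.diagonal fun x => if ∀ k : Fin n, (k : ℕ) + 1 ∈ S → x k = 0 then 1 else 0

/-- The fidelity `⟨ψ| P_S |ψ⟩` of jointly resetting the qudits in `S`, for fixed gates. -/
def fidelity (n q : ℕ) [NeZero q] (S : Finset ℕ) (U : Fin (n - 1) → TwoQuditUnitary q) : ℝ :=
  (star (rewoundState n q U) ⬝ᵥ (zeroProjector n q S).mulVec (rewoundState n q U)).re

/-- The fidelity averaged over independent Haar-random gates. -/
noncomputable def avgFidelity (n q : ℕ) [NeZero q] (S : Finset ℕ) : ℝ :=
  ∫ U, fidelity n q S U ∂(Measure.pi fun _ : Fin (n - 1) => haarProb q)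

/-- The connected correlation of the resets of the qudits `i` and `j`. -/
noncomputable def connectedCorrelation (n q : ℕ) [NeZero q] (i j : ℕ) : ℝ :=
  avgFidelity n q {i, j} - avgFidelity n q {i} * avgFidelity n q {j}

/-! ### Unitarily covariant maps on matrices -/

section Covariant

variable {I : Type*} [Fintype I] [DecidableEq I]

/-! Only the last gate touches the qudit still in use, so with `V` the product of all earlier gates
and `g` the last one, the fidelity is the `(0, 0)` entry of `V† (g† (V P V†) g) V`. The gates are
averaged one at a time, from the last to the first.

Averaging `g` depolarizes both qudits it acts on. The last qudit carries no projector and is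
untouched by `V`, so the net effect is one depolarized qudit, the one before it, inserted between
the backward and forward runs. Peeling off the next gate, on `a` and `b = a + 1`, requires the Haar
average of `g† Dep_b(g B g†) g`, which is `B / (q² + 1) + q² / (q² + 1) · Dep_a (Dep_b B)`
(`integral_conj_depolarize_conj_op`). With weight `1 / (q² + 1)` the rewinding becomes perfect and
contributes `1`. With weight `t = q² / (q² + 1)` the error moves to `a` and leaves `b` maximally
mixed, which costs a factor `1 / q` if `b` is to be reset. This is the recursion
`integral_prefixFidelity_succ`.

Thus the error performs a one-way walk that survives each step with probability `t`. It leaves qudit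
`i` mixed with probability `t ^ (n - i)`, and the closed forms follow by induction.

The Haar moments are found without Weingarten calculus. The averaged superoperator commutes with
unitary conjugation, hence has the form `B ↦ x B + y tr(B) 1` (`UnitarilyCovariant.exists_eq`). For
the second moment, `x` and `y` are fixed by unitality and by the trace of the superoperator, both
preserved by the averaging (`twirl_depolarizeSnd`). -/

theorem Matrix.diagonal_mem_unitaryGroup_of_sign (w : I → ℂ) (hw : ∀ i, w i = 1 ∨ w i = -1) :
    Matrix.diagonal w ∈ Matrix.unitaryGroup I ℂ := by
  rw [Matrix.mem_unitaryGroup_iff, Matrix.star_eq_conjTranspose, Matrix.diagonal_conjTranspose,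
    Matrix.diagonal_mul_diagonal, ← Matrix.diagonal_one]
  congr 1
  ext i
  rcases hw i with h | h <;> simp [h]

theorem Matrix.permMatrix_mem_unitaryGroup (σ : Equiv.Perm I) :
    σ.permMatrix ℂ ∈ Matrix.unitaryGroup I ℂ := by
  rw [Matrix.mem_unitaryGroup_iff, Matrix.star_eq_conjTranspose, Matrix.conjTranspose_permMatrix,
    ← Matrix.permMatrix_mul, inv_mul_cancel, Matrix.permMatrix_one]

theorem Matrix.permMatrix_conj (σ : Equiv.Perm I) (B : Matrix I I ℂ) :
    σ.permMatrix ℂ * B * star (σ.permMatrix ℂ) = B.submatrix σ σ := by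
  rw [Matrix.star_eq_conjTranspose, Matrix.conjTranspose_permMatrix, Equiv.Perm.permMatrix,
    Equiv.Perm.permMatrix, PEquiv.toMatrix_toPEquiv_mul, PEquiv.mul_toMatrix_toPEquiv]
  rfl

omit [Fintype I] in
theorem Equiv.Perm.exists_apply_eq_apply_eq {a c a' c' : I} (h : a ≠ c) (h' : a' ≠ c') :
    ∃ σ : Equiv.Perm I, σ a = a' ∧ σ c = c' := by
  have h1 : Equiv.swap a a' c ≠ a' := by
    intro h2
    rw [Equiv.swap_apply_eq_iff, Equiv.swap_apply_right] at h2
    exact h h2.symm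
  refine ⟨(Equiv.swap a a').trans (Equiv.swap (Equiv.swap a a' c) c'), ?_, ?_⟩
  · simp only [Equiv.trans_apply, Equiv.swap_apply_left]
    exact Equiv.swap_apply_of_ne_of_ne h1.symm h'
  · simp

/-- Linear maps that commute with conjugation by unitaries. -/
def UnitarilyCovariant (Φ : Matrix I I ℂ →ₗ[ℂ] Matrix I I ℂ) : Prop :=
  ∀ W ∈ Matrix.unitaryGroup I ℂ, ∀ B, Φ (W * B * star W) = W * Φ B * star W

theorem UnitarilyCovariant.single_off_diagonal {Φ : Matrix I I ℂ →ₗ[ℂ] Matrix I I ℂ}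
    (hΦ : UnitarilyCovariant Φ) (a : I) {c d : I} (hcd : c ≠ d) :
    Φ (Matrix.single a a 1) c d = 0 := by
  -- Conjugation by the reflection that flips the sign of basis vector `c` fixes the diagonal matrix
  -- unit at `a`, but negates every `(c, d)` entry with `d ≠ c`; such an entry of the image must
  -- vanish.
  set w : I → ℂ := fun i => if i = c then -1 else 1 with hw
  have hW := Matrix.diagonal_mem_unitaryGroup_of_sign w
    (fun i => by by_cases h : i = c <;> simp [hw, h])
  have h1 := hΦ _ hW (Matrix.single a a 1)
  have hs : star (Matrix.diagonal w) = Matrix.diagonal w := by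
    rw [Matrix.star_eq_conjTranspose, Matrix.diagonal_conjTranspose]
    congr 1
    ext i
    by_cases h : i = c <;> simp [hw, h]
  have h2 : Matrix.diagonal w * Matrix.single a a (1 : ℂ) * star (Matrix.diagonal w)
      = Matrix.single a a 1 := by
    rw [hs]
    ext i j
    rw [Matrix.mul_diagonal, Matrix.diagonal_mul, Matrix.single_apply]
    by_cases h : a = i ∧ a = j
    · obtain ⟨rfl, rfl⟩ := h
      by_cases h : a = c <;> simp [hw, h]
    · simp [h]
  rw [h2, hs] at h1
  have h3 := congrFun (congrFun h1 c) d
  rw [Matrix.mul_diagonal, Matrix.diagonal_mul] at h3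
  simp only [hw, if_true, if_neg hcd.symm] at h3
  linear_combination (1 / 2 : ℂ) * h3

theorem UnitarilyCovariant.single_perm {Φ : Matrix I I ℂ →ₗ[ℂ] Matrix I I ℂ}
    (hΦ : UnitarilyCovariant Φ) (σ : Equiv.Perm I) (a c : I) :
    Φ (Matrix.single (σ a) (σ a) 1) (σ c) (σ c) = Φ (Matrix.single a a 1) c c := by
  have h1 := hΦ _ (Matrix.permMatrix_mem_unitaryGroup σ) (Matrix.single (σ a) (σ a) 1)
  rw [Matrix.permMatrix_conj, Matrix.permMatrix_conj] at h1
  have h2 : (Matrix.single (σ a) (σ a) (1 : ℂ)).submatrix σ σ = Matrix.single a a 1 := by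
    ext i j
    simp [Matrix.single_apply]
  rw [h2] at h1
  simpa using (congrFun (congrFun h1 c) c).symm

/-- The image is diagonal by sign flips. Permutations act transitively on points and on ordered
pairs of distinct points, so its diagonal takes only two values, one at `a` and one elsewhere, and
neither depends on `a`. -/
theorem UnitarilyCovariant.exists_single [Nontrivial I] {Φ : Matrix I I ℂ →ₗ[ℂ] Matrix I I ℂ}
    (hΦ : UnitarilyCovariant Φ) :
    ∃ x y : ℂ, ∀ a, Φ (Matrix.single a a 1) = x • Matrix.single a a 1 + y • 1 := by
  obtain ⟨a₀, c₀, h₀⟩ := exists_pair_ne I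
  refine ⟨Φ (Matrix.single a₀ a₀ 1) a₀ a₀ - Φ (Matrix.single a₀ a₀ 1) c₀ c₀,
    Φ (Matrix.single a₀ a₀ 1) c₀ c₀, fun a => ?_⟩
  ext c d
  by_cases hcd : c = d
  · subst hcd
    by_cases hac : a = c
    · subst hac
      have := hΦ.single_perm (Equiv.swap a₀ a) a₀ a₀
      simp only [Equiv.swap_apply_left] at this
      simp [this]
    · obtain ⟨σ, rfl, rfl⟩ := Equiv.Perm.exists_apply_eq_apply_eq h₀ hac
      rw [hΦ.single_perm]
      simp [h₀]
  · rw [hΦ.single_off_diagonal a hcd]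
    have : ¬ (a = c ∧ a = d) := fun h => hcd (h.1.symm.trans h.2)
    simp [hcd, this]

/-- Linearity passes from diagonal matrix units to diagonal matrices, covariance and the spectral
theorem to Hermitian matrices, and the decomposition into real and imaginary parts to all matrices.
-/
theorem UnitarilyCovariant.exists_eq [Nontrivial I] {Φ : Matrix I I ℂ →ₗ[ℂ] Matrix I I ℂ}
    (hΦ : UnitarilyCovariant Φ) :
    ∃ x y : ℂ, ∀ B, Φ B = x • B + (y * B.trace) • (1 : Matrix I I ℂ) := by
  obtain ⟨x, y, h⟩ := hΦ.exists_single
  have hdiag (w : I → ℂ) :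
      Φ (Matrix.diagonal w) = x • Matrix.diagonal w + (y * ∑ i, w i) • (1 : Matrix I I ℂ) := by
    have hw : Matrix.diagonal w = ∑ i, w i • Matrix.single i i (1 : ℂ) := by
      rw [← Matrix.sum_single_eq_diagonal]
      simp [Matrix.smul_single]
    rw [hw, map_sum, Finset.smul_sum, Finset.mul_sum, Finset.sum_smul, ← Finset.sum_add_distrib]
    refine Finset.sum_congr rfl fun i _ => ?_
    rw [map_smul, h, smul_add, smul_comm, smul_smul (w i), mul_comm (w i)]
  have hherm (A : Matrix I I ℂ) (hA : A.IsHermitian) :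
      Φ A = x • A + (y * A.trace) • (1 : Matrix I I ℂ) := by
    have hs := hA.spectral_theorem
    rw [Unitary.conjStarAlgAut_apply] at hs
    set W : Matrix I I ℂ := (hA.eigenvectorUnitary : Matrix I I ℂ)
    have hW : W ∈ Matrix.unitaryGroup I ℂ := hA.eigenvectorUnitary.2
    set w : I → ℂ := RCLike.ofReal ∘ hA.eigenvalues
    have htr : A.trace = ∑ i, w i := by
      conv_lhs => rw [hs]
      rw [Matrix.trace_mul_comm, ← mul_assoc, (Matrix.mem_unitaryGroup_iff').1 hW, one_mul,
        Matrix.trace_diagonal]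
    rw [htr]
    conv_lhs => rw [hs]
    rw [hΦ _ hW, hdiag, mul_add, add_mul, mul_smul_comm, smul_mul_assoc, ← hs, mul_smul_comm,
      smul_mul_assoc, mul_one, (Matrix.mem_unitaryGroup_iff).1 hW]
  refine ⟨x, y, fun B => ?_⟩
  rw [← realPart_add_I_smul_imaginaryPart B, map_add, map_smul,
    hherm _ (realPart B).2, hherm _ (imaginaryPart B).2]
  simp only [Matrix.trace_add, Matrix.trace_smul, smul_add, mul_add, add_smul, smul_smul,
    smul_eq_mul]
  rw [mul_comm x Complex.I, mul_left_comm y Complex.I]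
  abel

theorem LinearMap.trace_eq_sum_single (L : Matrix I I ℂ →ₗ[ℂ] Matrix I I ℂ) :
    LinearMap.trace ℂ _ L = ∑ s, ∑ t, L (Matrix.single s t 1) s t := by
  rw [LinearMap.trace_eq_matrix_trace ℂ (Matrix.stdBasis ℂ I I), Matrix.trace,
    Fintype.sum_prod_type]
  refine Finset.sum_congr rfl fun s _ => Finset.sum_congr rfl fun t _ => ?_
  rw [Matrix.diag_apply, LinearMap.toMatrix_apply, Matrix.stdBasis_eq_single]
  rfl

end Covariant

/-! ### Haar measure -/

instance haarProb.instIsHaarMeasure (q : ℕ) : (haarProb q).IsHaarMeasure := by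
  unfold haarProb; infer_instance

instance haarProb.instIsProbabilityMeasure (q : ℕ) : IsProbabilityMeasure (haarProb q) :=
  ⟨Measure.haarMeasure_self (K₀ := (⊤ : TopologicalSpace.PositiveCompacts (TwoQuditUnitary q)))⟩

/-- A right translate of Haar measure is again a left-invariant probability measure, so uniqueness
identifies the two. -/
instance haarProb.instIsMulRightInvariant (q : ℕ) : (haarProb q).IsMulRightInvariant where
  map_mul_right_eq_self g := by
    have : IsProbabilityMeasure (Measure.map (· * g) (haarProb q)) :=
      Measure.isProbabilityMeasure_map (measurable_mul_const g).aemeasurable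
    exact Measure.isHaarMeasure_eq_of_isProbabilityMeasure _ _

instance TwoQuditUnitary.instSecondCountableTopology (q : ℕ) :
    SecondCountableTopology (TwoQuditUnitary q) := by
  have : SecondCountableTopology (Matrix (Fin q × Fin q) (Fin q × Fin q) ℂ) :=
    inferInstanceAs (SecondCountableTopology (Fin q × Fin q → Fin q × Fin q → ℂ))
  exact TopologicalSpace.Subtype.secondCountableTopology _

/-- Resampling one coordinate independently does not change a product law; Fubini then integrates
the fresh coordinate first. This allows one gate to be averaged while the others stay fixed. -/
theorem integral_pi_update {ι G E : Type*} [Fintype ι] [DecidableEq ι] [MeasurableSpace G]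
    [NormedAddCommGroup E] [NormedSpace ℝ E] (μ : Measure G) [IsProbabilityMeasure μ] (k : ι)
    {f : (ι → G) → E} (hf : Integrable f (Measure.pi fun _ => μ)) :
    ∫ U, f U ∂(Measure.pi fun _ => μ)
      = ∫ U, ∫ W, f (Function.update U k W) ∂μ ∂(Measure.pi fun _ => μ) := by
  have hmeas : Measurable fun p : (ι → G) × G => Function.update p.1 k p.2 := by
    refine measurable_pi_lambda _ fun i => ?_
    by_cases h : i = k
    · subst h; simpa using measurable_snd
    · simpa [h, Function.comp_def] using (measurable_pi_apply i).comp measurable_fst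
  have hmap : (Measure.pi fun _ : ι => μ)
      = ((Measure.pi fun _ : ι => μ).prod μ).map (fun p => Function.update p.1 k p.2) := by
    refine Measure.pi_eq fun s hs => ?_
    rw [Measure.map_apply hmeas (MeasurableSet.univ_pi hs)]
    -- The preimage of a box is a box: the old coordinate `k` is unconstrained, and the fresh value
    -- must lie in `s k`.
    have : (fun p : (ι → G) × G => Function.update p.1 k p.2) ⁻¹' Set.univ.pi s
        = (Set.univ.pi (Function.update s k Set.univ)) ×ˢ s k := by
      ext p
      simp only [Set.mem_preimage, Set.mem_pi, Set.mem_univ, true_imp_iff, Set.mem_prod]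
      constructor
      · intro h
        refine ⟨fun i => ?_, by simpa using h k⟩
        by_cases hi : i = k
        · subst hi; simp
        · simpa [hi] using h i
      · rintro ⟨h1, h2⟩ i
        by_cases hi : i = k
        · subst hi; simpa using h2
        · simpa [hi] using h1 i
    rw [this, Measure.prod_prod, Measure.pi_pi, ← Finset.mul_prod_erase _ _ (Finset.mem_univ k),
      ← Finset.mul_prod_erase (a := k) _ (fun i => μ (s i)) (Finset.mem_univ k)]
    simp only [Function.update_self, measure_univ, one_mul]
    rw [mul_comm]
    congr 1
    refine Finset.prod_congr rfl fun i hi => ?_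
    rw [Function.update_of_ne (Finset.ne_of_mem_erase hi)]
  rw [hmap] at hf
  conv_lhs => rw [hmap]
  rw [integral_map hmeas.aemeasurable hf.1, integral_prod]
  exact (integrable_map_measure hf.1 hmeas.aemeasurable).1 hf

theorem LinearMap.apply_integral_entries {I X : Type*} [Fintype I] [DecidableEq I]
    [MeasurableSpace X] {μ : Measure X} (L : Matrix I I ℂ →ₗ[ℂ] ℂ) {F : X → Matrix I I ℂ}
    (hF : ∀ s t, Integrable (fun w => F w s t) μ) :
    L (Matrix.of fun s t => ∫ w, F w s t ∂μ) = ∫ w, L (F w) ∂μ := by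
  have hL (A : Matrix I I ℂ) : L A = ∑ s, ∑ t, A s t * L (Matrix.single s t 1) := by
    conv_lhs => rw [Matrix.matrix_eq_sum_single A]
    simp only [map_sum]
    refine Finset.sum_congr rfl fun s _ => Finset.sum_congr rfl fun t _ => ?_
    rw [← smul_eq_mul, ← map_smul, Matrix.smul_single, smul_eq_mul, mul_one]
  have hi (s t : I) : Integrable (fun w => F w s t * L (Matrix.single s t 1)) μ :=
    (hF s t).mul_const _
  rw [hL]
  simp only [hL (F _)]
  rw [integral_finsetSum _ fun s _ => integrable_finsetSum _ fun t _ => hi s t]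
  refine Finset.sum_congr rfl fun s _ => ?_
  rw [integral_finsetSum _ fun t _ => hi s t]
  refine Finset.sum_congr rfl fun t _ => ?_
  rw [integral_mul_const, Matrix.of_apply]

/-! ### Twirling -/

/-- Replace the second tensor factor by the maximally mixed state. -/
noncomputable def depolarizeSnd (I J : Type*) [Fintype J] [DecidableEq J] :
    Matrix (I × J) (I × J) ℂ →ₗ[ℂ] Matrix (I × J) (I × J) ℂ where
  toFun A := Matrix.of fun s t =>
    if s.2 = t.2 then (Fintype.card J : ℂ)⁻¹ * ∑ r, A (s.1, r) (t.1, r) else 0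
  map_add' A B := by
    ext s t
    by_cases h : s.2 = t.2 <;> simp [h, Finset.sum_add_distrib, mul_add]
  map_smul' c A := by
    ext s t
    by_cases h : s.2 = t.2 <;> simp [h, ← Finset.mul_sum, mul_left_comm]

theorem depolarizeSnd_apply {I J : Type*} [Fintype J] [DecidableEq J]
    (A : Matrix (I × J) (I × J) ℂ) (s t : I × J) :
    depolarizeSnd I J A s t =
      if s.2 = t.2 then (Fintype.card J : ℂ)⁻¹ * ∑ r, A (s.1, r) (t.1, r) else 0 := rfl

theorem depolarizeSnd_one {I J : Type*} [Fintype J] [DecidableEq J] [Nonempty J] [DecidableEq I] :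
    depolarizeSnd I J 1 = 1 := by
  ext s t
  have hc : (Fintype.card J : ℂ) ≠ 0 := by simp
  by_cases h : s.2 = t.2
  · by_cases h1 : s.1 = t.1
    · have : s = t := Prod.ext h1 h
      subst this
      simp [depolarizeSnd_apply]
    · have : s ≠ t := fun h2 => h1 (congrArg Prod.fst h2)
      simp [depolarizeSnd_apply, h1, this]
  · have : s ≠ t := fun h2 => h (congrArg Prod.snd h2)
    simp [depolarizeSnd_apply, h, this]

/-- The map is a projection onto the operators `A ⊗ 1`, a space of dimension `|I|²`. -/
theorem trace_depolarizeSnd (I J : Type*) [Fintype I] [Fintype J] [DecidableEq I] [DecidableEq J]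
    [Nonempty J] :
    LinearMap.trace ℂ _ (depolarizeSnd I J) = (Fintype.card I : ℂ) ^ 2 := by
  have hc : (Fintype.card J : ℂ) ≠ 0 := by simp
  rw [LinearMap.trace_eq_sum_single]
  have h (s t : I × J) : depolarizeSnd I J (Matrix.single s t 1) s t
      = if s.2 = t.2 then (Fintype.card J : ℂ)⁻¹ else 0 := by
    rw [depolarizeSnd_apply]
    by_cases h : s.2 = t.2
    · have : ∀ r, (s = (s.1, r) ∧ t = (t.1, r)) ↔ s.2 = r := fun r => by
        simp [Prod.ext_iff, ← h]
      simp [h, Matrix.single_apply, this]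
    · simp [h]
  simp only [h, Fintype.sum_prod_type, Finset.sum_ite_eq, Finset.mem_univ, if_true,
    Finset.sum_const, Finset.card_univ, nsmul_eq_mul, Fintype.card_prod, Nat.cast_mul]
  field_simp

/-- Conjugation `B ↦ W B W†`. -/
def conjLinear {I : Type*} [Fintype I] (W : Matrix I I ℂ) : Matrix I I ℂ →ₗ[ℂ] Matrix I I ℂ where
  toFun B := W * B * star W
  map_add' A B := by rw [mul_add, add_mul]
  map_smul' c A := by simp

/-- The superoperator `D` in the frame rotated by `W`: the map `B ↦ W† D(W B W†) W`. -/
def rotated {I : Type*} [Fintype I] (D : Matrix I I ℂ →ₗ[ℂ] Matrix I I ℂ) (W : Matrix I I ℂ) :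
    Matrix I I ℂ →ₗ[ℂ] Matrix I I ℂ :=
  conjLinear (star W) ∘ₗ D ∘ₗ conjLinear W

theorem rotated_apply {I : Type*} [Fintype I] (D : Matrix I I ℂ →ₗ[ℂ] Matrix I I ℂ)
    (W B : Matrix I I ℂ) : rotated D W B = star W * D (W * B * star W) * W := by
  simp [rotated, conjLinear]

theorem trace_rotated {I : Type*} [Fintype I] [DecidableEq I]
    (D : Matrix I I ℂ →ₗ[ℂ] Matrix I I ℂ) {W : Matrix I I ℂ} (hW : W ∈ Matrix.unitaryGroup I ℂ) :
    LinearMap.trace ℂ _ (rotated D W) = LinearMap.trace ℂ _ D := by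
  rw [rotated, LinearMap.trace_comp_comm', LinearMap.comp_assoc]
  have : conjLinear W ∘ₗ conjLinear (star W) = LinearMap.id := by
    ext1 B
    simp only [conjLinear, LinearMap.comp_apply, LinearMap.coe_mk, AddHom.coe_mk, star_star,
      LinearMap.id_apply]
    rw [← mul_assoc, ← mul_assoc, (Matrix.mem_unitaryGroup_iff).1 hW, one_mul, mul_assoc,
      (Matrix.mem_unitaryGroup_iff).1 hW, mul_one]
  rw [this, LinearMap.comp_id]

/-! ### Haar averages of superoperators and their first two moments. -/

section

variable {q : ℕ}

theorem integrable_of_continuous_unitary {E : Type*} [NormedAddCommGroup E]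
    [SecondCountableTopologyEither (TwoQuditUnitary q) E]
    {f : TwoQuditUnitary q → E} (hf : Continuous f) :
    Integrable f (haarProb q) :=
  hf.integrable_of_hasCompactSupport (HasCompactSupport.of_compactSpace f)

theorem continuous_rotated (D : Matrix (Fin q × Fin q) (Fin q × Fin q) ℂ →ₗ[ℂ]
      Matrix (Fin q × Fin q) (Fin q × Fin q) ℂ) (B : Matrix (Fin q × Fin q) (Fin q × Fin q) ℂ) :
    Continuous fun W : TwoQuditUnitary q => rotated D W B := by
  have hD : Continuous D := D.continuous_of_finiteDimensional
  simp only [rotated_apply]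
  have hU : Continuous fun W : TwoQuditUnitary q =>
    (W : Matrix (Fin q × Fin q) (Fin q × Fin q) ℂ) := continuous_subtype_val
  have hU' : Continuous fun W : TwoQuditUnitary q =>
    star (W : Matrix (Fin q × Fin q) (Fin q × Fin q) ℂ) := hU.star
  exact (hU'.matrix_mul (hD.comp ((hU.matrix_mul continuous_const).matrix_mul hU'))).matrix_mul hU

theorem integrable_rotated (D : Matrix (Fin q × Fin q) (Fin q × Fin q) ℂ →ₗ[ℂ] Matrix (Fin q × Fin q) (Fin q × Fin q) ℂ) (B : Matrix (Fin q × Fin q) (Fin q × Fin q) ℂ) (L : Matrix (Fin q × Fin q) (Fin q × Fin q) ℂ →ₗ[ℂ] ℂ) :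
    Integrable (fun W : TwoQuditUnitary q => L (rotated D W B)) (haarProb q) :=
  integrable_of_continuous_unitary
    (L.continuous_of_finiteDimensional.comp (continuous_rotated D B))

/-- The Haar average of the rotated superoperator. -/
noncomputable def twirl (D : Matrix (Fin q × Fin q) (Fin q × Fin q) ℂ →ₗ[ℂ] Matrix (Fin q × Fin q) (Fin q × Fin q) ℂ) : Matrix (Fin q × Fin q) (Fin q × Fin q) ℂ →ₗ[ℂ] Matrix (Fin q × Fin q) (Fin q × Fin q) ℂ where
  toFun B := Matrix.of fun s t => ∫ W : TwoQuditUnitary q, rotated D W B s t ∂haarProb q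
  map_add' A B := by
    ext s t
    simp only [map_add, Matrix.add_apply, Matrix.of_apply]
    exact integral_add (integrable_rotated D A (Matrix.entryLinearMap ℂ ℂ s t))
      (integrable_rotated D B (Matrix.entryLinearMap ℂ ℂ s t))
  map_smul' c A := by
    ext s t
    simp only [map_smul, Matrix.smul_apply, Matrix.of_apply, RingHom.id_apply]
    exact integral_smul c _

theorem twirl_apply (D : Matrix (Fin q × Fin q) (Fin q × Fin q) ℂ →ₗ[ℂ] Matrix (Fin q × Fin q) (Fin q × Fin q) ℂ) (B : Matrix (Fin q × Fin q) (Fin q × Fin q) ℂ) (s t : Fin q × Fin q) :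
    twirl D B s t = ∫ W : TwoQuditUnitary q, rotated D W B s t ∂haarProb q := rfl

theorem map_twirl (L : Matrix (Fin q × Fin q) (Fin q × Fin q) ℂ →ₗ[ℂ] ℂ) (D : Matrix (Fin q × Fin q) (Fin q × Fin q) ℂ →ₗ[ℂ] Matrix (Fin q × Fin q) (Fin q × Fin q) ℂ) (B : Matrix (Fin q × Fin q) (Fin q × Fin q) ℂ) :
    L (twirl D B) = ∫ W : TwoQuditUnitary q, L (rotated D W B) ∂haarProb q :=
  L.apply_integral_entries fun s t => integrable_rotated D B (Matrix.entryLinearMap ℂ ℂ s t)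

/-- Conjugating the integrand by `V` and replacing `W` by `W V` turns `rotated D W B` into `rotated
D W (V B V†)`, so right invariance gives covariance. -/
theorem twirl_covariant (D : Matrix (Fin q × Fin q) (Fin q × Fin q) ℂ →ₗ[ℂ] Matrix (Fin q × Fin q) (Fin q × Fin q) ℂ) : UnitarilyCovariant (twirl D) := by
  intro V hV B
  ext s t
  have h : (V * twirl D B * star V) s t
      = (Matrix.entryLinearMap ℂ ℂ s t ∘ₗ conjLinear V) (twirl D B) := rfl
  rw [h, map_twirl, twirl_apply, ← integral_mul_right_eq_self (fun W : TwoQuditUnitary q =>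
    (Matrix.entryLinearMap ℂ ℂ s t ∘ₗ conjLinear V) (rotated D W B)) ⟨V, hV⟩]
  congr 1
  ext1 W
  rw [LinearMap.comp_apply, Matrix.entryLinearMap_apply]
  simp only [rotated_apply, conjLinear, LinearMap.coe_mk, AddHom.coe_mk, Submonoid.coe_mul,
    star_mul, ← mul_assoc, (Matrix.mem_unitaryGroup_iff).1 hV, one_mul]
  rw [mul_assoc _ V (star V), (Matrix.mem_unitaryGroup_iff).1 hV, mul_one]

theorem twirl_one {D : Matrix (Fin q × Fin q) (Fin q × Fin q) ℂ →ₗ[ℂ]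
      Matrix (Fin q × Fin q) (Fin q × Fin q) ℂ} (hD : D 1 = 1) : twirl D 1 = 1 := by
  have h (W : TwoQuditUnitary q) :
      rotated D (W : Matrix (Fin q × Fin q) (Fin q × Fin q) ℂ) 1 = 1 := by
    rw [rotated_apply, mul_one, (Matrix.mem_unitaryGroup_iff).1 W.2, hD, mul_one,
      (Matrix.mem_unitaryGroup_iff').1 W.2]
  ext s t
  simp [twirl_apply, h]

/-- Each rotated copy of `D` is similar to `D`, so the trace is constant under the integral. -/
theorem trace_twirl (D : Matrix (Fin q × Fin q) (Fin q × Fin q) ℂ →ₗ[ℂ]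
      Matrix (Fin q × Fin q) (Fin q × Fin q) ℂ) :
    LinearMap.trace ℂ _ (twirl D) = LinearMap.trace ℂ _ D := by
  have h (s t : Fin q × Fin q) : twirl D (Matrix.single s t 1) s t
      = ∫ W : TwoQuditUnitary q, rotated D W (Matrix.single s t 1) s t ∂haarProb q :=
    map_twirl (Matrix.entryLinearMap ℂ ℂ s t) D _
  have hi (s t : Fin q × Fin q) : Integrable (fun W : TwoQuditUnitary q =>
      rotated D W (Matrix.single s t 1) s t) (haarProb q) :=
    integrable_of_continuous_unitary ((continuous_rotated D _).matrix_elem s t)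
  rw [LinearMap.trace_eq_sum_single]
  simp only [h]
  simp only [← integral_finsetSum _ fun t _ => hi _ t]
  rw [← integral_finsetSum _ fun s _ => integrable_finsetSum _ fun t _ => hi s t]
  simp only [← LinearMap.trace_eq_sum_single]
  simp [fun W : TwoQuditUnitary q => trace_rotated D W.2]

/-- Unitality gives `x + q² y = 1`; the trace gives `q⁴ x + q² y = q²`. The solution is `x = y = 1 /
(q² + 1)`. -/
theorem twirl_depolarizeSnd (hq : 2 ≤ q) (B : Matrix (Fin q × Fin q) (Fin q × Fin q) ℂ) :
    twirl (depolarizeSnd (Fin q) (Fin q)) B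
      = ((q : ℂ) ^ 2 + 1)⁻¹ • B + (((q : ℂ) ^ 2 + 1)⁻¹ * B.trace) • 1 := by
  have : NeZero q := ⟨by omega⟩
  have : Nontrivial (Fin q) := Fin.nontrivial_iff_two_le.2 hq
  obtain ⟨x, y, h⟩ := (twirl_covariant (depolarizeSnd (Fin q) (Fin q))).exists_eq
  have h1 := h 1
  rw [twirl_one depolarizeSnd_one] at h1
  have h1' := congrFun (congrFun h1 (0, 0)) (0, 0)
  simp at h1'
  have h2 := trace_twirl (depolarizeSnd (Fin q) (Fin q))
  rw [trace_depolarizeSnd, LinearMap.trace_eq_sum_single] at h2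
  have h3 (s t : Fin q × Fin q) :
      twirl (depolarizeSnd (Fin q) (Fin q)) (Matrix.single s t 1) s t
        = x + if s = t then y else 0 := by
    rw [h]
    by_cases hst : s = t
    · subst hst; simp
    · simp [hst]
  simp only [h3, Finset.sum_add_distrib, Finset.sum_const, Finset.sum_ite_eq, Finset.mem_univ,
    if_true, Finset.card_univ, nsmul_eq_mul] at h2
  simp at h2
  have hq0 : (q : ℂ) ≠ 0 := by simp; omega
  have hq1 : (q : ℂ) ^ 2 + 1 ≠ 0 := by
    have : ((q ^ 2 + 1 : ℕ) : ℂ) ≠ 0 := Nat.cast_ne_zero.2 (by omega)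
    exact_mod_cast this
  have hq2 : (q : ℂ) ^ 2 - 1 ≠ 0 := by
    intro h
    have : ((q ^ 2 : ℕ) : ℂ) = ((1 : ℕ) : ℂ) := by push_cast; linear_combination h
    have := Nat.cast_injective this
    nlinarith
  have hx : x = ((q : ℂ) ^ 2 + 1)⁻¹ := by
    -- Eliminating `y` leaves `(q⁴ - 1) x = q² - 1`; the common factor `q² - 1` is nonzero because
    -- `q ≥ 2`.
    have e : ((q : ℂ) ^ 2 - 1) * (x * ((q : ℂ) ^ 2 + 1) - 1) = 0 := by
      linear_combination h2 + h1'
    have := (mul_eq_zero.1 e).resolve_left hq2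
    field_simp
    linear_combination this
  have hy : y = ((q : ℂ) ^ 2 + 1)⁻¹ := by
    have e : (q : ℂ) ^ 2 * (y * ((q : ℂ) ^ 2 + 1) - 1) = 0 := by
      rw [hx] at h1'
      field_simp at h1'
      linear_combination - h1'
    have := (mul_eq_zero.1 e).resolve_left (pow_ne_zero _ hq0)
    field_simp
    linear_combination this
  rw [h, hx, hy]

/-- The first moment of the Haar measure: the average of `W† B W` is a multiple of the identity. -/
theorem integral_conj_apply (hq : 2 ≤ q) (B : Matrix (Fin q × Fin q) (Fin q × Fin q) ℂ) (s t : Fin q × Fin q) :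
    ∫ W : TwoQuditUnitary q, (star (W : Matrix (Fin q × Fin q) (Fin q × Fin q) ℂ) * B * (W : Matrix (Fin q × Fin q) (Fin q × Fin q) ℂ)) s t ∂haarProb q
      = ((q : ℂ) ^ 2)⁻¹ * B.trace * (1 : Matrix (Fin q × Fin q) (Fin q × Fin q) ℂ) s t := by
  have : NeZero q := ⟨by omega⟩
  have : Nontrivial (Fin q) := Fin.nontrivial_iff_two_le.2 hq
  have hq0 : (q : ℂ) ≠ 0 := by simp; omega
  -- For the map `A ↦ tr(A) B`, the rotated map is `A ↦ tr(A) W† B W`, so the first moment is also a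
  -- twirl.
  set D : Matrix (Fin q × Fin q) (Fin q × Fin q) ℂ →ₗ[ℂ] Matrix (Fin q × Fin q) (Fin q × Fin q) ℂ := (Matrix.traceLinearMap (Fin q × Fin q) ℂ ℂ).smulRight B with hD
  have hrot (W : TwoQuditUnitary q) (A : Matrix (Fin q × Fin q) (Fin q × Fin q) ℂ) :
      rotated D W A = A.trace • (star (W : Matrix (Fin q × Fin q) (Fin q × Fin q) ℂ) * B * (W : Matrix (Fin q × Fin q) (Fin q × Fin q) ℂ)) := by
    rw [rotated_apply, hD, LinearMap.smulRight_apply, Matrix.traceLinearMap_apply,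
      Matrix.trace_mul_comm, ← mul_assoc, (Matrix.mem_unitaryGroup_iff').1 W.2, one_mul,
      mul_smul_comm, smul_mul_assoc]
  obtain ⟨x, y, h⟩ := (twirl_covariant D).exists_eq
  obtain ⟨a, c, hac⟩ := exists_pair_ne (Fin q × Fin q)
  -- An off-diagonal matrix unit has trace zero, so the twirl kills it and only the `x` term could
  -- survive.
  have hx : x = 0 := by
    have h1 := congrFun (congrFun (h (Matrix.single a c 1)) a) c
    rw [twirl_apply] at h1
    simpa [hrot, hac, Matrix.trace_single_eq_of_ne] using h1.symm
  have hy : (q : ℂ) ^ 2 * y = B.trace := by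
    have h1 := trace_twirl D
    rw [LinearMap.trace_eq_sum_single] at h1
    have h2 : LinearMap.trace ℂ _ D = B.trace := by
      rw [LinearMap.trace_eq_sum_single, Matrix.trace]
      refine Finset.sum_congr rfl fun s _ => ?_
      rw [Finset.sum_eq_single s]
      · simp [hD]
      · intro t _ ht
        simp [hD, Matrix.trace_single_eq_of_ne _ _ _ ht.symm]
      · simp
    have h3 (s t : Fin q × Fin q) : twirl D (Matrix.single s t 1) s t = if s = t then y else 0 := by
      rw [h, hx]
      by_cases hst : s = t
      · subst hst; simp
      · simp [hst]
    simp only [h2, h3, Finset.sum_ite_eq, Finset.mem_univ, if_true, Finset.sum_const,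
      Finset.card_univ, nsmul_eq_mul, Fintype.card_prod, Fintype.card_fin, Nat.cast_mul] at h1
    linear_combination h1
  have h1 := congrFun (congrFun (h (Matrix.single a a 1)) s) t
  rw [twirl_apply] at h1
  simp only [hrot, Matrix.trace_single_eq_same, one_mul, hx, zero_smul, zero_add, mul_one,
    Matrix.smul_apply, smul_eq_mul] at h1
  rw [h1, ← hy]
  field_simp

end

/-! ### Gates on `n` qudits -/

section Gates

variable {n q : ℕ}

/-- The basis state `x` with the qudits `a` and `b` set to the values `s`. -/
def place (a b : Fin n) (x : Fin n → Fin q) (s : Fin q × Fin q) : Fin n → Fin q :=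
  Function.update (Function.update x a s.1) b s.2

theorem place_self (a b : Fin n) (x : Fin n → Fin q) : place a b x (x a, x b) = x := by
  simp [place]

theorem place_left {a b : Fin n} (h : a ≠ b) (x : Fin n → Fin q) (s : Fin q × Fin q) :
    place a b x s a = s.1 := by
  simp [place, h]

theorem place_right (a b : Fin n) (x : Fin n → Fin q) (s : Fin q × Fin q) :
    place a b x s b = s.2 := by
  simp [place]

theorem place_of_ne {a b k : Fin n} (ha : k ≠ a) (hb : k ≠ b) (x : Fin n → Fin q)
    (s : Fin q × Fin q) : place a b x s k = x k := by
  simp [place, ha, hb]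

theorem place_injective {a b : Fin n} (h : a ≠ b) (x : Fin n → Fin q) :
    Function.Injective (place a b x) := by
  intro s t hst
  have h1 := congrFun hst a
  have h2 := congrFun hst b
  rw [place_left h, place_left h] at h1
  rw [place_right, place_right] at h2
  exact Prod.ext h1 h2

theorem place_place (a b : Fin n) (x : Fin n → Fin q) (s t : Fin q × Fin q) :
    place a b (place a b x s) t = place a b x t := by
  ext k
  by_cases hb : k = b
  · subst hb; simp [place]
  · by_cases ha : k = a
    · subst ha; simp [place, hb]
    · simp [place, ha, hb]

theorem place_update {a b k : Fin n} (ha : k ≠ a) (hb : k ≠ b) (x : Fin n → Fin q) (r : Fin q)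
    (s : Fin q × Fin q) :
    place a b (Function.update x k r) s = Function.update (place a b x s) k r := by
  rw [place, place, Function.update_comm ha, Function.update_comm hb]

theorem place_update_right (a b : Fin n) (x : Fin n → Fin q) (s : Fin q × Fin q) (r : Fin q) :
    Function.update (place a b x s) b r = place a b x (s.1, r) := by
  simp [place]

theorem Gate.op_apply_of_agree (g : Gate n q) {x y : Fin n → Fin q}
    (h : ∀ k, k ≠ g.a → k ≠ g.b → x k = y k) :
    g.op x y = (g.U : Matrix (Fin q × Fin q) (Fin q × Fin q) ℂ) (x g.a, x g.b) (y g.a, y g.b) :=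
  if_pos h

theorem Gate.op_apply_of_not_agree (g : Gate n q) {x y : Fin n → Fin q}
    (h : ¬ ∀ k, k ≠ g.a → k ≠ g.b → x k = y k) : g.op x y = 0 :=
  if_neg h

theorem Gate.sum_op_mul (g : Gate n q) (x : Fin n → Fin q) (f : (Fin n → Fin q) → ℂ) :
    ∑ z, g.op x z * f z = ∑ r, (g.U : Matrix (Fin q × Fin q) (Fin q × Fin q) ℂ)
      (x g.a, x g.b) r * f (place g.a g.b x r) := by
  symm
  refine Fintype.sum_of_injective (place g.a g.b x) (place_injective g.ne x) _ _ ?_ ?_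
  · intro z hz
    have : ¬ ∀ k, k ≠ g.a → k ≠ g.b → x k = z k := by
      intro h
      refine hz ⟨(z g.a, z g.b), ?_⟩
      ext k
      by_cases hb : k = g.b
      · rw [hb, place_right]
      · by_cases ha : k = g.a
        · rw [ha, place_left g.ne]
        · rw [place_of_ne ha hb, h k ha hb]
    rw [g.op_apply_of_not_agree this, zero_mul]
  · intro r
    have : ∀ k, k ≠ g.a → k ≠ g.b → x k = place g.a g.b x r k := fun k ha hb =>
      (place_of_ne ha hb x r).symm
    rw [g.op_apply_of_agree this, place_left g.ne, place_right]

theorem Gate.op_conjTranspose (g : Gate n q) : g.op.conjTranspose = g.dagger.op := by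
  ext x y
  rw [Matrix.conjTranspose_apply]
  by_cases h : ∀ k, k ≠ g.a → k ≠ g.b → x k = y k
  · rw [g.op_apply_of_agree fun k ha hb => (h k ha hb).symm, g.dagger.op_apply_of_agree h]
    rfl
  · rw [g.op_apply_of_not_agree fun h' => h fun k ha hb => (h' k ha hb).symm,
      g.dagger.op_apply_of_not_agree h, star_zero]

theorem Gate.op_conjTranspose_mul_self (g : Gate n q) : g.op.conjTranspose * g.op = 1 := by
  rw [g.op_conjTranspose]
  ext x y
  rw [Matrix.mul_apply, Gate.sum_op_mul]
  simp only [Gate.dagger]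
  by_cases h : ∀ k, k ≠ g.a → k ≠ g.b → x k = y k
  · have hr (r : Fin q × Fin q) : ∀ k, k ≠ g.a → k ≠ g.b → place g.a g.b x r k = y k :=
      fun k ha hb => by rw [place_of_ne ha hb, h k ha hb]
    simp only [fun r => g.op_apply_of_agree (hr r), place_left g.ne, place_right]
    have := congrFun (congrFun ((Matrix.mem_unitaryGroup_iff').1 g.U.2) (x g.a, x g.b))
      (y g.a, y g.b)
    rw [Matrix.mul_apply] at this
    refine this.trans ?_
    rw [Matrix.one_apply, Matrix.one_apply]
    congr 1
    refine propext ⟨fun hab => ?_, fun hxy => by rw [hxy]⟩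
    rw [Prod.mk.injEq] at hab
    ext k
    by_cases ha : k = g.a
    · rw [ha, hab.1]
    · by_cases hb : k = g.b
      · rw [hb, hab.2]
      · rw [h k ha hb]
  · have hxy : x ≠ y := fun hxy => h fun k _ _ => by rw [hxy]
    have hr (r : Fin q × Fin q) : ¬ ∀ k, k ≠ g.a → k ≠ g.b → place g.a g.b x r k = y k :=
      fun h' => h fun k ha hb => by rw [← h' k ha hb, place_of_ne ha hb]
    simp [fun r => g.op_apply_of_not_agree (hr r), hxy]

/-- The block of `B` on the qudits `a` and `b`, for fixed values of the other qudits given by the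
row `x` and the column `y`. -/
def block (a b : Fin n) (x y : Fin n → Fin q) (B : QuditOp n q) :
    Matrix (Fin q × Fin q) (Fin q × Fin q) ℂ :=
  Matrix.of fun s t => B (place a b x s) (place a b y t)

theorem block_apply_self (a b : Fin n) (x y : Fin n → Fin q) (B : QuditOp n q) :
    block a b x y B (x a, x b) (y a, y b) = B x y := by
  simp only [block, Matrix.of_apply, place_self]

/-- A gate on `a` and `b` does not mix different values of the other qudits, so it multiplies each
`q² × q²` block by its unitary. Averages over one gate thereby reduce to averages over `U(q²)`. -/
theorem block_op_mul (g : Gate n q) (x y : Fin n → Fin q) (B : QuditOp n q) :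
    block g.a g.b x y (g.op * B) = g.U * block g.a g.b x y B := by
  ext s t
  rw [block, Matrix.of_apply, Matrix.mul_apply, Gate.sum_op_mul, Matrix.mul_apply]
  simp only [place_left g.ne, place_right, place_place]
  rfl

theorem block_conjTranspose (a b : Fin n) (x y : Fin n → Fin q) (B : QuditOp n q) :
    block a b x y B.conjTranspose = (block a b y x B).conjTranspose := rfl

theorem block_mul_op_conjTranspose (g : Gate n q) (x y : Fin n → Fin q) (B : QuditOp n q) :
    block g.a g.b x y (B * g.op.conjTranspose)
      = block g.a g.b x y B * star (g.U : Matrix (Fin q × Fin q) (Fin q × Fin q) ℂ) := by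
  have h := congrArg Matrix.conjTranspose (block_op_mul g y x B.conjTranspose)
  rw [← block_conjTranspose, Matrix.conjTranspose_mul, Matrix.conjTranspose_mul,
    Matrix.conjTranspose_conjTranspose, ← block_conjTranspose, Matrix.conjTranspose_conjTranspose]
    at h
  exact h

theorem block_conjTranspose_op_mul (g : Gate n q) (x y : Fin n → Fin q) (B : QuditOp n q) :
    block g.a g.b x y (g.op.conjTranspose * B)
      = star (g.U : Matrix (Fin q × Fin q) (Fin q × Fin q) ℂ) * block g.a g.b x y B := by
  rw [g.op_conjTranspose]
  exact block_op_mul g.dagger x y B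

theorem block_mul_op (g : Gate n q) (x y : Fin n → Fin q) (B : QuditOp n q) :
    block g.a g.b x y (B * g.op) = block g.a g.b x y B * g.U := by
  have h := block_mul_op_conjTranspose g.dagger x y B
  rw [← g.op_conjTranspose, Matrix.conjTranspose_conjTranspose] at h
  rw [show g.a = g.dagger.a from rfl, show g.b = g.dagger.b from rfl, h]
  simp [Gate.dagger]

/-! ### Depolarizing a qudit -/

/-- Replace the qudit `k` by the maximally mixed state. -/
noncomputable def depolarize (k : Fin n) : QuditOp n q →ₗ[ℂ] QuditOp n q where
  toFun A := Matrix.of fun x y =>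
    if x k = y k then (q : ℂ)⁻¹ * ∑ r, A (Function.update x k r) (Function.update y k r) else 0
  map_add' A B := by
    ext x y
    by_cases h : x k = y k <;> simp [h, Finset.sum_add_distrib, mul_add]
  map_smul' c A := by
    ext x y
    by_cases h : x k = y k <;> simp [h, ← Finset.mul_sum, mul_left_comm]

theorem depolarize_apply (k : Fin n) (A : QuditOp n q) (x y : Fin n → Fin q) :
    depolarize k A x y = if x k = y k then
      (q : ℂ)⁻¹ * ∑ r, A (Function.update x k r) (Function.update y k r) else 0 := rfl

theorem depolarize_conjTranspose (k : Fin n) (A : QuditOp n q) :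
    depolarize k A.conjTranspose = (depolarize k A).conjTranspose := by
  ext x y
  rw [Matrix.conjTranspose_apply, depolarize_apply, depolarize_apply]
  by_cases h : x k = y k
  · simp [h]
  · simp [h, Ne.symm h]

/-- Operations on disjoint sets of qudits commute. -/
theorem depolarize_op_mul (g : Gate n q) {k : Fin n} (ha : k ≠ g.a) (hb : k ≠ g.b)
    (A : QuditOp n q) : depolarize k (g.op * A) = g.op * depolarize k A := by
  ext x y
  rw [depolarize_apply, Matrix.mul_apply, Gate.sum_op_mul]
  simp only [Matrix.mul_apply, Gate.sum_op_mul, depolarize_apply, place_of_ne ha hb,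
    place_update ha hb, Function.update_of_ne ha.symm, Function.update_of_ne hb.symm]
  by_cases h : x k = y k
  · simp only [if_pos h, Finset.mul_sum]
    rw [Finset.sum_comm]
    exact Finset.sum_congr rfl fun r _ => Finset.sum_congr rfl fun t _ => by ring
  · simp [h]

theorem depolarize_mul_op_conjTranspose (g : Gate n q) {k : Fin n} (ha : k ≠ g.a) (hb : k ≠ g.b)
    (A : QuditOp n q) :
    depolarize k (A * g.op.conjTranspose) = depolarize k A * g.op.conjTranspose := by
  have h := congrArg Matrix.conjTranspose (depolarize_op_mul g ha hb A.conjTranspose)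
  rwa [← depolarize_conjTranspose, Matrix.conjTranspose_mul, Matrix.conjTranspose_conjTranspose,
    Matrix.conjTranspose_mul, ← depolarize_conjTranspose, Matrix.conjTranspose_conjTranspose] at h

theorem block_depolarize_right (a b : Fin n) (x y : Fin n → Fin q) (B : QuditOp n q) :
    block a b x y (depolarize b B) = depolarizeSnd (Fin q) (Fin q) (block a b x y B) := by
  ext s t
  rw [block, Matrix.of_apply, depolarize_apply, depolarizeSnd_apply]
  simp only [place_right, place_update_right, Fintype.card_fin]
  rfl

theorem depolarize_depolarize_apply {a b : Fin n} (h : a ≠ b) (B : QuditOp n q)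
    (x y : Fin n → Fin q) :
    depolarize a (depolarize b B) x y = ((q : ℂ) ^ 2)⁻¹ * (block a b x y B).trace *
      (1 : Matrix (Fin q × Fin q) (Fin q × Fin q) ℂ) (x a, x b) (y a, y b) := by
  rw [depolarize_apply, Matrix.one_apply, Matrix.trace, Fintype.sum_prod_type]
  by_cases hxa : x a = y a
  · simp only [depolarize_apply, Function.update_of_ne h.symm, hxa, if_true, Prod.mk.injEq,
      true_and]
    by_cases hxb : x b = y b
    · simp only [hxb, if_true, ← Finset.mul_sum, block, Matrix.diag_apply, Matrix.of_apply, place,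
        mul_one]
      ring
    · simp [hxb]
  · simp [hxa]

/-! ### Averaging over one gate -/

theorem integral_conj_op (hq : 2 ≤ q) {a b : Fin n} (h : a ≠ b) (B : QuditOp n q)
    (x y : Fin n → Fin q) :
    ∫ W : TwoQuditUnitary q,
        ((Gate.mk a b h W).op.conjTranspose * B * (Gate.mk a b h W).op) x y ∂haarProb q
      = depolarize a (depolarize b B) x y := by
  rw [depolarize_depolarize_apply h, ← integral_conj_apply hq]
  congr 1
  ext1 W
  refine (block_apply_self a b x y _).symm.trans (congrFun (congrFun ?_ _) _)
  rw [block_mul_op ⟨a, b, h, W⟩, block_conjTranspose_op_mul ⟨a, b, h, W⟩]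

theorem integral_conj_depolarize_conj_op (hq : 2 ≤ q) {a b : Fin n} (h : a ≠ b) (B : QuditOp n q)
    (x y : Fin n → Fin q) :
    ∫ W : TwoQuditUnitary q, ((Gate.mk a b h W).op.conjTranspose *
        depolarize b ((Gate.mk a b h W).op * B * (Gate.mk a b h W).op.conjTranspose) *
        (Gate.mk a b h W).op) x y ∂haarProb q
      = ((q : ℂ) ^ 2 + 1)⁻¹ * B x y
        + (q : ℂ) ^ 2 * ((q : ℂ) ^ 2 + 1)⁻¹ * depolarize a (depolarize b B) x y := by
  have h1 := congrFun (congrFun (twirl_depolarizeSnd hq (block a b x y B)) (x a, x b)) (y a, y b)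
  rw [twirl_apply, Matrix.add_apply, Matrix.smul_apply, Matrix.smul_apply, block_apply_self] at h1
  have hq0 : (q : ℂ) ≠ 0 := by simp; omega
  rw [depolarize_depolarize_apply h]
  -- `Dep_a (Dep_b B)` already contains the normalization `1 / q²` of the trace term, hence the
  -- coefficient `q² / (q² + 1)`.
  have h2 : ((q : ℂ) ^ 2 + 1)⁻¹ * B x y + (q : ℂ) ^ 2 * ((q : ℂ) ^ 2 + 1)⁻¹ *
      (((q : ℂ) ^ 2)⁻¹ * (block a b x y B).trace *
        (1 : Matrix (Fin q × Fin q) (Fin q × Fin q) ℂ) (x a, x b) (y a, y b))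
      = ((q : ℂ) ^ 2 + 1)⁻¹ • B x y + (((q : ℂ) ^ 2 + 1)⁻¹ * (block a b x y B).trace) •
        (1 : Matrix (Fin q × Fin q) (Fin q × Fin q) ℂ) (x a, x b) (y a, y b) := by
    simp only [smul_eq_mul]
    field_simp
  rw [h2, ← h1]
  congr 1
  ext1 W
  refine (block_apply_self a b x y _).symm.trans (congrFun (congrFun ?_ _) _)
  rw [block_mul_op ⟨a, b, h, W⟩, block_conjTranspose_op_mul ⟨a, b, h, W⟩, block_depolarize_right,
    block_mul_op_conjTranspose ⟨a, b, h, W⟩, block_op_mul ⟨a, b, h, W⟩, rotated_apply]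

end Gates

/-! ### The convolutional circuit -/

section Circuit

variable {n q : ℕ}

theorem circuitOp_append (C D : List (Gate n q)) :
    circuitOp (C ++ D) = circuitOp D * circuitOp C := by
  simp [circuitOp]

theorem circuitOp_singleton (g : Gate n q) : circuitOp [g] = g.op := by
  simp [circuitOp]

theorem circuitOp_dagger_reverse (C : List (Gate n q)) :
    circuitOp (C.map Gate.dagger).reverse = (circuitOp C).conjTranspose := by
  induction C with
  | nil => simp [circuitOp]
  | cons g C ih =>
    rw [List.map_cons, List.reverse_cons, circuitOp_append, ih, circuitOp_singleton,
      ← g.op_conjTranspose, ← Matrix.conjTranspose_mul, ← circuitOp_singleton g,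
      ← circuitOp_append, List.singleton_append]

/-- The gate number `k` of the convolutional circuit. -/
def convGate (U : Fin (n - 1) → TwoQuditUnitary q) (k : Fin (n - 1)) : Gate n q where
  a := ⟨k, by omega⟩
  b := ⟨k + 1, by omega⟩
  ne := by simp
  U := U k

/-- The first `m` gates of the convolutional circuit. -/
def prefixOp (U : Fin (n - 1) → TwoQuditUnitary q) (m : ℕ) : QuditOp n q :=
  circuitOp ((convCircuit n q U).take m)

theorem convCircuit_eq_ofFn (U : Fin (n - 1) → TwoQuditUnitary q) :
    convCircuit n q U = List.ofFn (convGate U) := rfl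

theorem prefixOp_zero (U : Fin (n - 1) → TwoQuditUnitary q) : prefixOp U 0 = 1 := by
  simp [prefixOp, circuitOp]

theorem take_succ_convCircuit (U : Fin (n - 1) → TwoQuditUnitary q) {m : ℕ} (hm : m < n - 1) :
    (convCircuit n q U).take (m + 1) = (convCircuit n q U).take m ++ [convGate U ⟨m, hm⟩] := by
  rw [List.take_succ_eq_append_getElem (by simpa [convCircuit] using hm)]
  simp [convCircuit_eq_ofFn]

theorem prefixOp_succ (U : Fin (n - 1) → TwoQuditUnitary q) {m : ℕ} (hm : m < n - 1) :
    prefixOp U (m + 1) = (convGate U ⟨m, hm⟩).op * prefixOp U m := by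
  rw [prefixOp, take_succ_convCircuit U hm, circuitOp_append, circuitOp_singleton, prefixOp]

theorem prefixOp_conjTranspose_mul_self (U : Fin (n - 1) → TwoQuditUnitary q) {m : ℕ}
    (hm : m ≤ n - 1) : (prefixOp U m).conjTranspose * prefixOp U m = 1 := by
  induction m with
  | zero => simp [prefixOp_zero]
  | succ m ih =>
    rw [prefixOp_succ U hm, Matrix.conjTranspose_mul, mul_assoc, ← mul_assoc (Gate.op _).conjTranspose,
      Gate.op_conjTranspose_mul_self, one_mul, ih (by omega)]

theorem prefixOp_update (U : Fin (n - 1) → TwoQuditUnitary q) (k : Fin (n - 1))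
    (W : TwoQuditUnitary q) {m : ℕ} (hm : m ≤ k) :
    prefixOp (Function.update U k W) m = prefixOp U m := by
  induction m with
  | zero => simp [prefixOp_zero]
  | succ m ih =>
    have hmn : m < n - 1 := by omega
    rw [prefixOp_succ _ hmn, prefixOp_succ _ hmn, ih (by omega)]
    have : (⟨m, hmn⟩ : Fin (n - 1)) ≠ k := fun h => by
      have := congrArg Fin.val h
      simp at this
      omega
    rw [convGate, convGate, Function.update_of_ne this]

theorem continuous_gate_op {a b : Fin n} (h : a ≠ b) :
    Continuous fun W : TwoQuditUnitary q => (Gate.mk a b h W).op := by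
  refine continuous_matrix fun x y => ?_
  simp only [Gate.op, Matrix.of_apply]
  by_cases hxy : ∀ k, k ≠ a → k ≠ b → x k = y k
  · simp only [if_pos hxy]
    exact continuous_subtype_val.matrix_elem _ _
  · simp only [if_neg hxy]
    exact continuous_const

theorem continuous_convGate_op (k : Fin (n - 1)) :
    Continuous fun U : Fin (n - 1) → TwoQuditUnitary q => (convGate U k).op :=
  (continuous_gate_op (a := ⟨k, by omega⟩) (b := ⟨k + 1, by omega⟩) (by simp)).comp
    (continuous_apply k)

theorem continuous_prefixOp {m : ℕ} (hm : m ≤ n - 1) :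
    Continuous fun U : Fin (n - 1) → TwoQuditUnitary q => prefixOp U m := by
  induction m with
  | zero => simp only [prefixOp_zero]; exact continuous_const
  | succ m ih =>
    simp only [prefixOp_succ _ hm]
    exact (continuous_convGate_op _).matrix_mul (ih (by omega))

theorem integrable_of_continuous_gates {f : (Fin (n - 1) → TwoQuditUnitary q) → ℂ}
    (hf : Continuous f) : Integrable f (Measure.pi fun _ => haarProb q) :=
  hf.integrable_of_hasCompactSupport (HasCompactSupport.of_compactSpace f)

/-- The first `m` gates touch only the qudits with index at most `m`, so depolarizing a later qudit
commutes with them. -/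
theorem depolarize_prefixOp_conj (U : Fin (n - 1) → TwoQuditUnitary q) {m : ℕ} {k : Fin n}
    (hm : m < k) (A : QuditOp n q) :
    depolarize k (prefixOp U m * A * (prefixOp U m).conjTranspose)
      = prefixOp U m * depolarize k A * (prefixOp U m).conjTranspose := by
  induction m generalizing A with
  | zero => simp [prefixOp_zero]
  | succ m ih =>
    have ha : k ≠ (convGate U ⟨m, by omega⟩).a := by
      simp only [convGate, ne_eq, Fin.ext_iff]; omega
    have hb : k ≠ (convGate U ⟨m, by omega⟩).b := by
      simp only [convGate, ne_eq, Fin.ext_iff]; omega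
    rw [prefixOp_succ U (by omega), Matrix.conjTranspose_mul]
    simp only [← mul_assoc]
    rw [depolarize_mul_op_conjTranspose _ ha hb, mul_assoc, mul_assoc, depolarize_op_mul _ ha hb,
      ← mul_assoc (prefixOp U m), ih (by omega)]
    simp only [mul_assoc]

/-- Every gate except the last acts on two idle qudits; the last one touches the qudit of index `n -
1`, which is not idle. -/
theorem circuitOp_rewind (U : Fin (n - 1) → TwoQuditUnitary q) (hn : 2 ≤ n) :
    circuitOp (rewind (idleQudits n) (convCircuit n q U)) = (prefixOp U (n - 2)).conjTranspose := by
  have hn' : n - 2 < n - 1 := by omega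
  have h1 : convCircuit n q U = (convCircuit n q U).take (n - 2) ++ [convGate U ⟨n - 2, hn'⟩] := by
    rw [← take_succ_convCircuit, List.take_of_length_le]
    simp only [convCircuit, List.length_ofFn]
    omega
  have h2 : ∀ g ∈ (convCircuit n q U).take (n - 2),
      decide (g.a ∈ idleQudits n ∧ g.b ∈ idleQudits n) = true := by
    intro g hg
    obtain ⟨i, hi, rfl⟩ := List.mem_take_iff_getElem.1 hg
    simp only [convCircuit_eq_ofFn, List.length_ofFn] at hi
    simp only [convCircuit_eq_ofFn, List.getElem_ofFn, convGate, idleQudits, Finset.mem_filter,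
      Finset.mem_univ, true_and, decide_eq_true_eq]
    omega
  rw [rewind, h1, List.filter_append, List.filter_eq_self.2 h2, List.filter_eq_nil_iff.2,
    List.append_nil, circuitOp_dagger_reverse, prefixOp]
  intro g hg
  rw [List.mem_singleton.1 hg]
  simp only [convGate, idleQudits, Finset.mem_filter, Finset.mem_univ, true_and, decide_eq_true_eq]
  omega

end Circuit

/-! ### Averaging the fidelity gate by gate -/

section Fidelity

variable {n q : ℕ} [NeZero q]

theorem zeroProjector_zero (S : Finset ℕ) : zeroProjector n q S 0 0 = 1 := by
  simp [zeroProjector]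

/-- The factor is the normalized trace on qudit `k`: `1 / q` for `|0⟩⟨0|` and `1` for the identity.
-/
theorem depolarize_zeroProjector (k : Fin n) (S : Finset ℕ) :
    depolarize k (zeroProjector n q S)
      = (if (k : ℕ) + 1 ∈ S then (q : ℂ)⁻¹ else 1) • zeroProjector n q (S.erase (k + 1)) := by
  have hq : (q : ℂ) ≠ 0 := NeZero.ne _
  have hw (x : Fin n → Fin q) (r : Fin q) :
      (∀ l : Fin n, (l : ℕ) + 1 ∈ S → Function.update x k r l = 0) ↔
        ((k : ℕ) + 1 ∈ S → r = 0) ∧ ∀ l : Fin n, (l : ℕ) + 1 ∈ S.erase (k + 1) → x l = 0 := by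
    constructor
    · intro h
      refine ⟨fun hk => by simpa using h k hk, fun l hl => ?_⟩
      have hlk : l ≠ k := fun hlk => by simp [hlk] at hl
      simpa [hlk] using h l (Finset.mem_of_mem_erase hl)
    · rintro ⟨h1, h2⟩ l hl
      by_cases hlk : l = k
      · subst hlk; simpa using h1 hl
      · have : (l : ℕ) ≠ k := fun h => hlk (Fin.ext h)
        simpa [hlk] using h2 l (Finset.mem_erase.2 ⟨by omega, hl⟩)
  ext x y
  rw [depolarize_apply, Matrix.smul_apply]
  by_cases hxy : x = y
  · subst hxy
    have hP (r : Fin q) : zeroProjector n q S (Function.update x k r) (Function.update x k r)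
        = (if (k : ℕ) + 1 ∈ S → r = 0 then 1 else 0) * zeroProjector n q (S.erase (k + 1)) x x := by
      rw [zeroProjector, zeroProjector, Matrix.diagonal_apply_eq, Matrix.diagonal_apply_eq]
      by_cases h1 : (k : ℕ) + 1 ∈ S → r = 0
      · by_cases h2 : ∀ l : Fin n, (l : ℕ) + 1 ∈ S.erase (k + 1) → x l = 0
        · rw [if_pos ((hw x r).2 ⟨h1, h2⟩), if_pos h1, if_pos h2, one_mul]
        · rw [if_neg fun h => h2 ((hw x r).1 h).2, if_neg h2, mul_zero]
      · rw [if_neg fun h => h1 ((hw x r).1 h).1, if_neg h1, zero_mul]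
    simp only [if_true, hP, ← Finset.sum_mul, smul_eq_mul, ← mul_assoc]
    congr 1
    by_cases hk : (k : ℕ) + 1 ∈ S <;> simp [hk, hq]
  · have h0 : zeroProjector n q (S.erase (k + 1)) x y = 0 := Matrix.diagonal_apply_ne _ hxy
    rw [h0, smul_zero]
    by_cases h : x k = y k
    · rw [if_pos h, Finset.sum_eq_zero, mul_zero]
      intro r _
      refine Matrix.diagonal_apply_ne _ fun h' => hxy ?_
      ext l
      by_cases hl : l = k
      · rw [hl, h]
      · simpa [hl] using congrArg Fin.val (congrFun h' l)
    · rw [if_neg h]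

theorem zeroState_eq_single : zeroState n q = Pi.single 0 1 := by
  ext x
  simp [zeroState, Pi.single_apply, funext_iff]

theorem fidelity_eq (U : Fin (n - 1) → TwoQuditUnitary q) (S : Finset ℕ) (hn : 2 ≤ n) :
    fidelity n q S U = (((prefixOp U (n - 2)).conjTranspose *
      ((convGate U ⟨n - 2, by omega⟩).op.conjTranspose *
        (prefixOp U (n - 2) * zeroProjector n q S * (prefixOp U (n - 2)).conjTranspose) *
        (convGate U ⟨n - 2, by omega⟩).op) * prefixOp U (n - 2)) 0 0).re := by
  have h1 : circuitOp (convCircuit n q U)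
      = (convGate U ⟨n - 2, by omega⟩).op * prefixOp U (n - 2) := by
    rw [← prefixOp_succ U (by omega), prefixOp, List.take_of_length_le]
    simp only [convCircuit, List.length_ofFn]
    omega
  rw [fidelity, rewoundState, circuitOp_rewind U hn, h1, zeroState_eq_single]
  congr 1
  generalize zeroProjector n q S = P
  generalize prefixOp U (n - 2) = V
  generalize (convGate U ⟨n - 2, by omega⟩).op = g
  rw [Matrix.star_mulVec, ← Matrix.dotProduct_mulVec, Matrix.mulVec_mulVec, Matrix.mulVec_mulVec,
    ← Pi.single_star, star_one, single_one_dotProduct, Matrix.mulVec_single_one, Matrix.col_apply,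
    Matrix.conjTranspose_mul, Matrix.conjTranspose_mul, Matrix.conjTranspose_conjTranspose]
  simp only [mul_assoc]

/-- The entry `⟨0| V† X V |0⟩` as a linear function of `X`. -/
def sandwich (V : QuditOp n q) : QuditOp n q →ₗ[ℂ] ℂ where
  toFun X := (V.conjTranspose * X * V) 0 0
  map_add' A B := by rw [mul_add, add_mul, Matrix.add_apply]
  map_smul' c A := by simp

theorem sandwich_apply (V X : QuditOp n q) : sandwich V X = (V.conjTranspose * X * V) 0 0 := rfl

theorem sandwich_op_mul (g V X : QuditOp n q) :
    sandwich (g * V) X = sandwich V (g.conjTranspose * X * g) := by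
  simp only [sandwich_apply, Matrix.conjTranspose_mul, mul_assoc]

/-- The fidelity after the last `n - 1 - m` gates have been averaged: only the first `m` gates are
left, and the qudit `m` (counted from `0`) is depolarized between the forward and backward runs. -/
noncomputable def prefixFidelity {m : ℕ} (hm : m < n) (S : Finset ℕ)
    (U : Fin (n - 1) → TwoQuditUnitary q) : ℂ :=
  sandwich (prefixOp U m) (depolarize ⟨m, hm⟩
    (prefixOp U m * zeroProjector n q S * (prefixOp U m).conjTranspose))

theorem continuous_prefixFidelity {m : ℕ} (hm : m < n) (S : Finset ℕ) :
    Continuous (prefixFidelity (q := q) hm S) := by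
  have hV := continuous_prefixOp (n := n) (q := q) (m := m) (by omega)
  have hV' := hV.matrix_conjTranspose
  have hD : Continuous (depolarize (q := q) (⟨m, hm⟩ : Fin n)) :=
    LinearMap.continuous_of_finiteDimensional _
  exact ((hV'.matrix_mul (hD.comp ((hV.matrix_mul continuous_const).matrix_mul hV'))).matrix_mul
    hV).matrix_elem 0 0

theorem prefixFidelity_zero (hn : 0 < n) {S : Finset ℕ} (hS : 1 ∉ S)
    (U : Fin (n - 1) → TwoQuditUnitary q) : prefixFidelity hn S U = 1 := by
  rw [prefixFidelity, prefixOp_zero, Matrix.conjTranspose_one, one_mul, mul_one,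
    depolarize_zeroProjector, sandwich_apply]
  simp [hS, zeroProjector_zero]

/-- One step of the walk: the error on index `m + 1`, that is qudit number `m + 2`, either
disappears or moves to index `m` and removes that number from `S`. -/
theorem integral_prefixFidelity_update (hq : 2 ≤ q) {m : ℕ} (hm : m + 1 < n) (S : Finset ℕ)
    (U : Fin (n - 1) → TwoQuditUnitary q) :
    ∫ W, prefixFidelity hm S (Function.update U ⟨m, by omega⟩ W) ∂haarProb q
      = ((q : ℂ) ^ 2 + 1)⁻¹ + (q : ℂ) ^ 2 * ((q : ℂ) ^ 2 + 1)⁻¹ *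
        (if m + 2 ∈ S then (q : ℂ)⁻¹ else 1) *
          prefixFidelity (Nat.lt_of_succ_lt hm) (S.erase (m + 2)) U := by
  have hk : m < n - 1 := by omega
  set a : Fin n := ⟨m, by omega⟩ with ha
  set b : Fin n := ⟨m + 1, hm⟩ with hb
  have hab : a ≠ b := by simp [ha, hb]
  set V := prefixOp U m with hV
  set B := V * zeroProjector n q S * V.conjTranspose with hB
  set F : TwoQuditUnitary q → QuditOp n q := fun W => (Gate.mk a b hab W).op.conjTranspose *
    depolarize b ((Gate.mk a b hab W).op * B * (Gate.mk a b hab W).op.conjTranspose) *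
    (Gate.mk a b hab W).op with hF
  have h1 (W : TwoQuditUnitary q) :
      prefixFidelity hm S (Function.update U ⟨m, hk⟩ W) = sandwich V (F W) := by
    have hg : convGate (Function.update U ⟨m, hk⟩ W) ⟨m, hk⟩ = ⟨a, b, hab, W⟩ := by
      simp [convGate, ha, hb]
    rw [prefixFidelity, prefixOp_succ _ hk, prefixOp_update U _ W le_rfl, hg, sandwich_op_mul,
      Matrix.conjTranspose_mul]
    simp only [hF, hB, mul_assoc]
    rfl
  have hcont : Continuous F := by
    have hg := continuous_gate_op (q := q) hab
    have hD : Continuous (depolarize (q := q) b) := LinearMap.continuous_of_finiteDimensional _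
    exact (hg.matrix_conjTranspose.matrix_mul (hD.comp ((hg.matrix_mul
      continuous_const).matrix_mul hg.matrix_conjTranspose))).matrix_mul hg
  have h2 : (Matrix.of fun x y => ∫ W, F W x y ∂haarProb q)
      = ((q : ℂ) ^ 2 + 1)⁻¹ • B
        + ((q : ℂ) ^ 2 * ((q : ℂ) ^ 2 + 1)⁻¹) • depolarize a (depolarize b B) := by
    ext x y
    exact integral_conj_depolarize_conj_op hq hab B x y
  have h3 : depolarize b B = (if m + 2 ∈ S then (q : ℂ)⁻¹ else 1) •
      (V * zeroProjector n q (S.erase (m + 2)) * V.conjTranspose) := by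
    rw [hB, hV, depolarize_prefixOp_conj U (by simp [hb]), depolarize_zeroProjector,
      mul_smul_comm, smul_mul_assoc]
  -- Without an error the rewinding is exact: `V† (V P V†) V = P`, whose `(0, 0)` entry is `1`.
  have h4 : sandwich V B = 1 := by
    have hu := prefixOp_conjTranspose_mul_self U hk.le
    rw [← hV] at hu
    rw [sandwich_apply, hB, ← mul_assoc, ← mul_assoc, hu, one_mul, mul_assoc, hu, mul_one,
      zeroProjector_zero]
  simp only [h1]
  rw [← LinearMap.apply_integral_entries _ fun x y =>
    integrable_of_continuous_unitary (hcont.matrix_elem x y), h2, h3, map_add, map_smul, map_smul,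
    map_smul, map_smul, h4]
  simp only [smul_eq_mul, mul_one, prefixFidelity]
  rw [mul_assoc ((q : ℂ) ^ 2 * _)]

theorem integral_prefixFidelity_succ (hq : 2 ≤ q) {m : ℕ} (hm : m + 1 < n) (S : Finset ℕ) :
    ∫ U, prefixFidelity (q := q) hm S U ∂(Measure.pi fun _ => haarProb q)
      = ((q : ℂ) ^ 2 + 1)⁻¹ + (q : ℂ) ^ 2 * ((q : ℂ) ^ 2 + 1)⁻¹ *
        (if m + 2 ∈ S then (q : ℂ)⁻¹ else 1) *
          ∫ U, prefixFidelity (q := q) (Nat.lt_of_succ_lt hm) (S.erase (m + 2)) U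
            ∂(Measure.pi fun _ => haarProb q) := by
  rw [integral_pi_update (haarProb q) ⟨m, by omega⟩
    (integrable_of_continuous_gates (continuous_prefixFidelity hm S))]
  simp only [integral_prefixFidelity_update hq hm S]
  rw [integral_add (integrable_const _)
    ((integrable_of_continuous_gates (continuous_prefixFidelity _ _)).const_mul _),
    integral_const_mul]
  simp

theorem avgFidelity_eq (hq : 2 ≤ q) (hn : 2 ≤ n) {S : Finset ℕ} (hS : n ∉ S) :
    avgFidelity n q S = (∫ U, prefixFidelity (q := q) (show n - 2 < n by omega) S U
      ∂(Measure.pi fun _ => haarProb q)).re := by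
  have hk : n - 2 < n - 1 := by omega
  set a : Fin n := ⟨n - 2, by omega⟩ with ha
  set b : Fin n := ⟨n - 2 + 1, by omega⟩ with hb
  have hab : a ≠ b := by simp [ha, hb]
  set f : (Fin (n - 1) → TwoQuditUnitary q) → ℂ := fun U => sandwich (prefixOp U (n - 2))
    ((convGate U ⟨n - 2, hk⟩).op.conjTranspose *
      (prefixOp U (n - 2) * zeroProjector n q S * (prefixOp U (n - 2)).conjTranspose) *
      (convGate U ⟨n - 2, hk⟩).op) with hf
  have hfc : Continuous f := by
    have hV := continuous_prefixOp (n := n) (q := q) hk.le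
    have hV' := hV.matrix_conjTranspose
    have hg := continuous_convGate_op (n := n) (q := q) ⟨n - 2, hk⟩
    exact ((hV'.matrix_mul ((hg.matrix_conjTranspose.matrix_mul
      ((hV.matrix_mul continuous_const).matrix_mul hV')).matrix_mul hg)).matrix_mul
      hV).matrix_elem 0 0
  have hfi := integrable_of_continuous_gates hfc
  have h0 : avgFidelity n q S = (∫ U, f U ∂(Measure.pi fun _ => haarProb q)).re := by
    rw [avgFidelity]
    simp only [fidelity_eq _ S hn]
    exact integral_re hfi
  rw [h0, integral_pi_update (haarProb q) ⟨n - 2, hk⟩ hfi]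
  congr 2
  ext1 U
  set V := prefixOp U (n - 2) with hV
  set B := V * zeroProjector n q S * V.conjTranspose with hB
  set F : TwoQuditUnitary q → QuditOp n q := fun W =>
    (Gate.mk a b hab W).op.conjTranspose * B * (Gate.mk a b hab W).op with hF
  have h1 (W : TwoQuditUnitary q) : f (Function.update U ⟨n - 2, hk⟩ W) = sandwich V (F W) := by
    have hg : convGate (Function.update U ⟨n - 2, hk⟩ W) ⟨n - 2, hk⟩ = ⟨a, b, hab, W⟩ := by
      simp [convGate, ha, hb]
    simp only [hf, prefixOp_update U ⟨n - 2, hk⟩ W le_rfl, hg]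
    rfl
  have hcont : Continuous F :=
    ((continuous_gate_op hab).matrix_conjTranspose.matrix_mul continuous_const).matrix_mul
      (continuous_gate_op hab)
  have h2 : (Matrix.of fun x y => ∫ W, F W x y ∂haarProb q) = depolarize a (depolarize b B) := by
    ext x y
    exact integral_conj_op hq hab B x y
  -- Index `b` is qudit number `n`, which is outside `S` and untouched by `V`, so depolarizing it
  -- changes nothing.
  have h3 : depolarize b B = B := by
    have hbS : (b : ℕ) + 1 ∉ S := by
      rwa [show (b : ℕ) + 1 = n by simp only [hb]; omega]
    rw [hB, hV, depolarize_prefixOp_conj U (by simp [hb]), depolarize_zeroProjector, if_neg hbS,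
      one_smul, Finset.erase_eq_of_notMem hbS]
  simp only [h1]
  rw [← LinearMap.apply_integral_entries _ fun x y =>
    integrable_of_continuous_unitary (hcont.matrix_elem x y), h2, h3]
  rfl

/-! ### Closed forms -/

theorem sq_add_one_ne_zero (q : ℕ) : (q : ℂ) ^ 2 + 1 ≠ 0 := by
  exact_mod_cast (Nat.succ_ne_zero (q ^ 2))

/-- The value `1` is a fixed point of the recursion when no qudit has to be reset. -/
theorem integral_prefixFidelity_empty (hq : 2 ≤ q) {m : ℕ} (hm : m < n) :
    ∫ U, prefixFidelity (q := q) hm ∅ U ∂(Measure.pi fun _ => haarProb q) = 1 := by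
  have hq1 := sq_add_one_ne_zero q
  induction m with
  | zero => simp [prefixFidelity_zero]
  | succ m ih =>
    rw [integral_prefixFidelity_succ hq, Finset.erase_empty, ih]
    simp only [Finset.notMem_empty, if_false]
    field_simp
    ring

/-- Here `d` counts the steps before the error reaches qudit `p + 2`. During them the deviation from
`1` is multiplied by `t = q² / (q² + 1)`; the step that passes the qudit contributes one more `t`
and the factor `1 - 1 / q`. -/
theorem integral_prefixFidelity_singleton (hq : 2 ≤ q) (p d : ℕ) (hm : p + 1 + d < n) :
    ∫ U, prefixFidelity (q := q) hm {p + 2} U ∂(Measure.pi fun _ => haarProb q)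
      = 1 - ((q : ℂ) - 1) / q * ((q : ℂ) ^ 2 / ((q : ℂ) ^ 2 + 1)) ^ (d + 1) := by
  have hq1 := sq_add_one_ne_zero q
  have hq0 : (q : ℂ) ≠ 0 := NeZero.ne _
  induction d with
  | zero =>
    have h : ({p + 2} : Finset ℕ).erase (p + 2) = ∅ := by simp
    simp only [Nat.add_zero]
    rw [integral_prefixFidelity_succ hq, h, integral_prefixFidelity_empty hq]
    simp only [Finset.mem_singleton, if_true, zero_add, pow_one]
    field_simp
    ring
  | succ d ih =>
    have h : p + 1 + d + 2 ∉ ({p + 2} : Finset ℕ) := by simp; omega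
    simp only [← Nat.add_assoc]
    rw [integral_prefixFidelity_succ hq, Finset.erase_eq_of_notMem h, if_neg h, ih,
      pow_succ _ (d + 1)]
    generalize ((q : ℂ) ^ 2 / ((q : ℂ) ^ 2 + 1)) ^ (d + 1) = z
    field_simp
    ring

/-- The walk meets the qudit with the larger number first; passing it costs `1 / q` and leaves the
singleton problem. The deviation from `1` becomes `t` times `1 - (1 / q) (1 - (q - 1) / q · t ^ (e +
1)) = (q - 1) / q · (1 + t ^ (e + 1) / q)`. -/
theorem integral_prefixFidelity_pair (hq : 2 ≤ q) (r e d : ℕ) (hm : r + 1 + e + 1 + d < n) :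
    ∫ U, prefixFidelity (q := q) hm {r + 1 + e + 2, r + 2} U ∂(Measure.pi fun _ => haarProb q)
      = 1 - ((q : ℂ) - 1) / q * ((q : ℂ) ^ 2 / ((q : ℂ) ^ 2 + 1)) ^ (d + 1) *
        (1 + 1 / (q : ℂ) * ((q : ℂ) ^ 2 / ((q : ℂ) ^ 2 + 1)) ^ (e + 1)) := by
  have hq1 := sq_add_one_ne_zero q
  have hq0 : (q : ℂ) ≠ 0 := NeZero.ne _
  induction d with
  | zero =>
    have h : ({r + 1 + e + 2, r + 2} : Finset ℕ).erase (r + 1 + e + 2) = {r + 2} := by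
      rw [Finset.erase_insert]
      simp
      omega
    simp only [Nat.add_zero]
    rw [integral_prefixFidelity_succ hq, h, integral_prefixFidelity_singleton hq,
      if_pos (Finset.mem_insert_self _ _), zero_add, pow_one]
    generalize ((q : ℂ) ^ 2 / ((q : ℂ) ^ 2 + 1)) ^ (e + 1) = z
    field_simp
    ring
  | succ d ih =>
    have h : r + 1 + e + 1 + d + 2 ∉ ({r + 1 + e + 2, r + 2} : Finset ℕ) := by
      simp; omega
    simp only [← Nat.add_assoc]
    rw [integral_prefixFidelity_succ hq, Finset.erase_eq_of_notMem h, if_neg h, ih,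
      pow_succ _ (d + 1)]
    generalize ((q : ℂ) ^ 2 / ((q : ℂ) ^ 2 + 1)) ^ (d + 1) = z
    generalize ((q : ℂ) ^ 2 / ((q : ℂ) ^ 2 + 1)) ^ (e + 1) = w
    field_simp
    ring

theorem avgFidelity_singleton (hq : 2 ≤ q) {i : ℕ} (hi : 1 < i) (hin : i < n) :
    avgFidelity n q {i} =
      1 - ((q : ℝ) - 1) / q * ((q : ℝ) ^ 2 / ((q : ℝ) ^ 2 + 1)) ^ (n - i) := by
  -- The averaging starts from index `n - 2 = p + 1 + d`, so the exponent `d + 1` equals `n - i`.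
  obtain ⟨p, rfl⟩ : ∃ p, i = p + 2 := ⟨i - 2, by omega⟩
  obtain ⟨d, rfl⟩ : ∃ d, n = p + 1 + d + 2 := ⟨n - p - 3, by omega⟩
  rw [avgFidelity_eq hq (by omega) (by simp; omega)]
  simp only [Nat.add_sub_cancel]
  rw [integral_prefixFidelity_singleton hq, show p + 1 + d + 2 - (p + 2) = d + 1 by omega,
    ← Complex.ofReal_re (1 - _)]
  congr 1
  push_cast
  rfl

theorem avgFidelity_pair (hq : 2 ≤ q) {i j : ℕ} (hj : 1 < j) (hji : j < i) (hin : i < n) :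
    avgFidelity n q {i, j} =
      1 - ((q : ℝ) - 1) / q * ((q : ℝ) ^ 2 / ((q : ℝ) ^ 2 + 1)) ^ (n - i) *
        (1 + 1 / (q : ℝ) * ((q : ℝ) ^ 2 / ((q : ℝ) ^ 2 + 1)) ^ (i - j)) := by
  obtain ⟨r, rfl⟩ : ∃ r, j = r + 2 := ⟨j - 2, by omega⟩
  obtain ⟨e, rfl⟩ : ∃ e, i = r + 1 + e + 2 := ⟨i - r - 3, by omega⟩
  obtain ⟨d, rfl⟩ : ∃ d, n = r + 1 + e + 1 + d + 2 := ⟨n - (r + 1 + e + 3), by omega⟩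
  rw [avgFidelity_eq hq (by omega) (by simp; omega)]
  simp only [Nat.add_sub_cancel]
  rw [integral_prefixFidelity_pair hq,
    show r + 1 + e + 1 + d + 2 - (r + 1 + e + 2) = d + 1 by omega,
    show r + 1 + e + 2 - (r + 2) = e + 1 by omega, ← Complex.ofReal_re (1 - _)]
  congr 1
  push_cast
  rfl

end Fidelity

/-! ### The three formulas. -/

theorem mainTheorem2 (n q : ℕ) [NeZero q] (hq : 2 ≤ q) :
    (∀ i : ℕ, 1 < i → i < n →
      avgFidelity n q {i} =
        1 - ((q : ℝ) - 1) / q * ((q : ℝ) ^ 2 / ((q : ℝ) ^ 2 + 1)) ^ (n - i)) ∧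
    (∀ i j : ℕ, 1 < j → j < i → i < n →
      avgFidelity n q {i, j} =
        1 - ((q : ℝ) - 1) / q * ((q : ℝ) ^ 2 / ((q : ℝ) ^ 2 + 1)) ^ (n - i) *
          (1 + 1 / (q : ℝ) * ((q : ℝ) ^ 2 / ((q : ℝ) ^ 2 + 1)) ^ (i - j))) ∧
    (∀ i j : ℕ, 1 < j → j < i → i < n →
      connectedCorrelation n q i j =
        (((q : ℝ) - 1) / q) ^ 2 * ((q : ℝ) ^ 2 / ((q : ℝ) ^ 2 + 1)) ^ (n - j) *
          (1 - ((q : ℝ) ^ 2 / ((q : ℝ) ^ 2 + 1)) ^ (n - i))) := by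
  refine ⟨fun i hi hin => avgFidelity_singleton hq hi hin,
    fun i j hj hji hin => avgFidelity_pair hq hj hji hin, fun i j hj hji hin => ?_⟩
  have hq0 : (q : ℝ) ≠ 0 := NeZero.ne _
  rw [connectedCorrelation, avgFidelity_pair hq hj hji hin,
    avgFidelity_singleton hq (hj.trans hji) hin, avgFidelity_singleton hq hj (hji.trans hin),
    -- Splitting the exponent makes both sides polynomials in `z = t ^ (n - i)` and `w = t ^ (i -
    -- j)`.
    show n - j = (n - i) + (i - j) by omega, pow_add]
  generalize ((q : ℝ) ^ 2 / ((q : ℝ) ^ 2 + 1)) ^ (n - i) = z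
  generalize ((q : ℝ) ^ 2 / ((q : ℝ) ^ 2 + 1)) ^ (i - j) = w
  field_simp
  ring
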